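/- Tree Hechler forcing $\mathbb{D}_{\mathrm{tree}}$ is the following partial order. Its conditions are trees $T\subseteq\omega^{<\omega}$ (sets of finite sequences closed under initial segments) with a distinguished node $\mathrm{stem}(T)\in T$ such that every $t\in T$ is comparable with $\mathrm{stem}(T)$ and, whenever $t\in T$ extends $\mathrm{stem}(T)$, we have $t^\frown n\in T$ for all but finitely many $n\in\omega$. The order is inclusion: $T'\le T$ iff $T'\subseteq T$. For $x,y\in\omega^\omega$ write $x\le^* y$ if $x(n)\le y(n)$ for all but finitely many $n$. In a generic extension of $V$, a real $y\in\omega^\omega$ is called dominating if $f\le^* y$ for all $f\in V\cap\omega^\omega$, and a real $x\in\omega^\omega$ is called unbounded if $x\not\le^* f$ for all $f\in V\cap\omega^\omega$. Theorem. Let $d$ be a $\mathbb{D}_{\mathrm{tree}}$-generic real over $V$. Then for every unbounded real $x\in\omega^\omega\cap V[d]$ there is a dominating real $y\in\omega^\omega\cap V[d]$ such that $x\not\le^* y$. (As usual for forcing over the universe $V$, this means that every condition of $\mathbb{D}_{\mathrm{tree}}$ forces the statement "for every unbounded real $x$ there is a dominating real $y$ with $x\not\le^* y$".) -/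

import Mathlib

/-! ### Forcing over the universe: names and the forcing relation

The ground model `V` is the universe of sets in `Type u` (Mathlib's `PSet.{u}` / `ZFSet.{u}`), and
statements about the generic extension `V[G]` are statements about names that are forced. -/

universe u v

/-- `P`-names over `V`: a name is a (small) family of pairs (name, condition). -/
inductive PName (P : Type v) : Type (max (u + 1) v)
  | mk (ι : Type u) (elt : ι → PName P) (cond : ι → P) : PName P

/-- The statements of the forcing language, identified with the predicate "`p` forces it". -/
abbrev ForcingProp (P : Type v) : Type v := P → Prop

/-- `p` forces the statement `φ`. -/
def Forces {P : Type v} (p : P) (φ : ForcingProp P) : Prop := φ p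

infix:50 " ⊩ " => Forces

namespace ForcingProp

variable {P : Type v} [Preorder P]

/-- `p ⊩ φ ∧ ψ` iff `p ⊩ φ` and `p ⊩ ψ`. -/
def and (φ ψ : ForcingProp P) : ForcingProp P := fun p => p ⊩ φ ∧ p ⊩ ψ

/-- `p ⊩ ¬ φ` iff no `q ≤ p` forces `φ`. -/
def not (φ : ForcingProp P) : ForcingProp P := fun p => ∀ q ≤ p, ¬ q ⊩ φ

/-- `p ⊩ ∀ a, φ a` iff `p ⊩ φ a` for every `a`. The range `ι` of the quantifier is the class of all
names (a quantifier over `V[G]`), or a collection of objects of `V` such as `ℕ` or `ℕ → ℕ`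
(a quantifier over objects of the ground model). -/
def all {ι : Sort*} (φ : ι → ForcingProp P) : ForcingProp P := fun p => ∀ a, p ⊩ φ a

/-- `φ → ψ` is `¬ (φ ∧ ¬ ψ)`. -/
def imp (φ ψ : ForcingProp P) : ForcingProp P := not (and φ (not ψ))

/-- `∃ a, φ a` is `¬ ∀ a, ¬ φ a`. -/
def ex {ι : Sort*} (φ : ι → ForcingProp P) : ForcingProp P := not (all fun a => not (φ a))

/-- A statement about the ground model only (such as `m ≤ n` for natural numbers). -/
def ground (a : Prop) : ForcingProp P := fun _ => a

end ForcingProp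

namespace PName

section

variable {P : Type v} [Preorder P]

/-- The forcing relation for `a = b`: `p ⊩ a = b` iff below `p`, every member of `a` is densely
forced to equal some member of `b`, and conversely. -/
def eq : PName.{u} P → PName.{u} P → ForcingProp P
  | ⟨α, a, s⟩, ⟨β, b, t⟩ => fun p =>
      (∀ i : α, ∀ q ≤ p, q ≤ s i → ∃ r ≤ q, ∃ j : β, r ≤ t j ∧ eq (a i) (b j) r) ∧
      (∀ j : β, ∀ q ≤ p, q ≤ t j → ∃ r ≤ q, ∃ i : α, r ≤ s i ∧ eq (a i) (b j) r)

/-- The forcing relation for `a ∈ b`: densely below `p` there are conditions below the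
condition attached to some member of `b` that force `a` to equal this member. -/
def mem (a : PName.{u} P) : PName.{u} P → ForcingProp P
  | ⟨β, b, t⟩ => fun p => ∀ q ≤ p, ∃ r ≤ q, ∃ j : β, r ≤ t j ∧ r ⊩ eq a (b j)

end

variable {P : Type v} [Preorder P] [OrderTop P]

/-- The canonical name of a set of the ground model. -/
def check : PSet.{u} → PName.{u} P
  | ⟨α, A⟩ => ⟨α, fun i => check (A i), fun _ => ⊤⟩

/-- The canonical name of the natural number `n` (a von Neumann numeral). -/
def num (n : ℕ) : PName.{u} P := check (PSet.ofNat n)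

/-- A name for the unordered pair `{a, b}`. -/
def upair (a b : PName.{u} P) : PName.{u} P :=
  ⟨ULift Bool, fun i => bif i.down then a else b, fun _ => ⊤⟩

/-- A name for the Kuratowski ordered pair `(a, b) = {{a}, {a, b}}`. -/
def opair (a b : PName.{u} P) : PName.{u} P := upair (upair a a) (upair a b)

/-- The canonical name of a real `f` of the ground model, as the set of pairs `(n, f n)`. -/
def groundReal (f : ℕ → ℕ) : PName.{u} P :=
  ⟨ULift ℕ, fun n => opair (num n.down) (num (f n.down)), fun _ => ⊤⟩

end PName

/-! ### Reals of the generic extension -/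

namespace ForcingProp

open PName

variable {P : Type v} [Preorder P] [OrderTop P]

/-- The statement `x(n) = m`, that is, `(n, m) ∈ x`. -/
def valueEq (x : PName.{u} P) (n m : ℕ) : ForcingProp P := mem (opair (num n) (num m)) x

/-- The statement `x ∈ ω^ω`: `x` is a set of pairs of natural numbers, and for every `n` there is
exactly one `m` with `(n, m) ∈ x`. -/
def isReal (x : PName.{u} P) : ForcingProp P :=
  and
    (all fun z : PName.{u} P =>
      imp (mem z x) (ex fun n : ℕ => ex fun m : ℕ => eq z (opair (num n) (num m))))
    (all fun n : ℕ => ex fun m : ℕ =>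
      and (valueEq x n m) (all fun k : ℕ => imp (valueEq x n k) (ground (k = m))))

/-- The statement `x ≤* y`, for reals `x` and `y`: `x(n) ≤ y(n)` for all but finitely many `n`. -/
def eventuallyLE (x y : PName.{u} P) : ForcingProp P :=
  ex fun N : ℕ => all fun n : ℕ => imp (ground (N ≤ n))
    (ex fun i : ℕ => ex fun j : ℕ => and (ground (i ≤ j)) (and (valueEq x n i) (valueEq y n j)))

/-- The statement that `y` is a dominating real (over `V`): `f ≤* y` for all `f ∈ V ∩ ω^ω`. -/
def isDominating (y : PName.{u} P) : ForcingProp P :=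
  and (isReal y) (all fun f : ℕ → ℕ => eventuallyLE (groundReal f) y)

/-- The statement that `x` is an unbounded real (over `V`): `x ≰* f` for all `f ∈ V ∩ ω^ω`. -/
def isUnbounded (x : PName.{u} P) : ForcingProp P :=
  and (isReal x) (all fun f : ℕ → ℕ => not (eventuallyLE x (groundReal f)))

end ForcingProp

/-! ### Tree Hechler forcing -/

/-- Conditions of tree Hechler forcing: trees `T ⊆ ω^{<ω}` with a distinguished node, the stem, such
that every node is comparable with the stem, and every node `t` extending the stem satisfies
`t ⌢ n ∈ T` for all but finitely many `n`. -/
structure TreeHechler where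
  tree : Descriptive.tree ℕ
  stem : List ℕ
  stem_mem : stem ∈ tree
  comparable : ∀ t ∈ tree, t <+: stem ∨ stem <+: t
  eventually_mem : ∀ t ∈ tree, stem <+: t → ∀ᶠ n in Filter.atTop, t ++ [n] ∈ tree

namespace TreeHechler

/-- `T' ≤ T` (the condition `T'` is stronger) iff `T' ⊆ T`. -/
instance : Preorder TreeHechler := Preorder.lift TreeHechler.tree

/-- The weakest condition is the full tree `ω^{<ω}` with empty stem. -/
instance : OrderTop TreeHechler where
  top :=
    { tree := ⊤
      stem := []
      stem_mem := trivial
      comparable := fun t _ => Or.inr t.nil_prefix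
      eventually_mem := fun _ _ _ => Filter.Eventually.of_forall fun _ => trivial }
  le_top T := (le_top : T.tree ≤ ⊤)

end TreeHechler

/-! A node s favors large values of x at n (`FavorsLarge`) if for every m there are infinitely many
k such that no condition with stem s⌢k bounds x(n) by m. If s does not, then conditions above
cofinitely many successors share a bound and glue to one condition with stem s that bounds x(n)
(`exists_bounds_of_not_favorsLarge`). If no node of a condition favored large values at any n ≥ N, a
fusion of these conditions (`exists_fusion`) would give an extension and a ground model f with x ≤*
f forced. So for unbounded x, favoring nodes are dense, with n arbitrarily large.

For each s fix such an n = ν(s), if there is one, and φ_s → ∞ such that for infinitely many k no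
condition with stem s⌢k bounds x(ν(s)) by φ_s(k). Let y(n) = φ_s(d(|s|)), where s is the first
initial segment of d with n < g(s), and g(s) exceeds |s| and ν(s). Each s answers for finitely many
n, so discarding finitely many successors per node makes y dominate any given f. At a favoring s,
y(ν(s)) is settled by the step to s⌢k at the latest, while x(ν(s)) can still be forced above it. -/

open Filter

/-! ### Unfolding the forcing relation -/

namespace ForcingProp

variable {P : Type v} [Preorder P]

theorem forces_ex_iff {ι : Sort*} {φ : ι → ForcingProp P} {p : P} :
    p ⊩ ex φ ↔ ∀ q ≤ p, ∃ a, ∃ r ≤ q, r ⊩ φ a := by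
  simp only [Forces, ex, not, all]
  push Not
  rfl

theorem forces_imp_iff {φ ψ : ForcingProp P} {p : P} :
    p ⊩ imp φ ψ ↔ ∀ q ≤ p, q ⊩ φ → ∃ r ≤ q, r ⊩ ψ := by
  simp only [Forces, imp, and, not]
  push Not
  rfl

end ForcingProp

/-! ### Equality and membership of names -/

namespace PName

section

variable {P : Type v} [Preorder P]

theorem mem_mono {a b : PName.{u} P} {p q : P} (h : p ⊩ mem a b) (hq : q ≤ p) : q ⊩ mem a b := by
  cases b
  exact fun r hr => h r (hr.trans hq)

theorem eq_mono {a b : PName.{u} P} {p q : P} (h : p ⊩ eq a b) (hq : q ≤ p) : q ⊩ eq a b := by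
  cases a
  cases b
  rw [Forces, eq] at h ⊢
  exact ⟨fun i r hr => h.1 i r (hr.trans hq), fun j r hr => h.2 j r (hr.trans hq)⟩

theorem eq_refl (a : PName.{u} P) (p : P) : p ⊩ eq a a := by
  induction a generalizing p with
  | mk ι a s ih =>
    rw [Forces, eq]
    exact ⟨fun i q _ hi => ⟨q, le_rfl, i, hi, ih i q⟩, fun i q _ hi => ⟨q, le_rfl, i, hi, ih i q⟩⟩

end

variable {P : Type v} [Preorder P] [OrderTop P]

theorem equiv_of_forces_eq_check (A B : PSet.{u}) (p : P) (h : p ⊩ eq (check A) (check B)) :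
    PSet.Equiv A B := by
  induction A generalizing B p with
  | mk α A ih =>
    obtain ⟨β, B⟩ := B
    rw [Forces, check, check, eq] at h
    refine ⟨fun i => ?_, fun j => ?_⟩
    · obtain ⟨r, -, j, -, hr⟩ := h.1 i p le_rfl le_top
      exact ⟨j, ih i _ r hr⟩
    · obtain ⟨r, -, i, -, hr⟩ := h.2 j p le_rfl le_top
      exact ⟨i, ih i _ r hr⟩

/-- The unordered pair of two pre-sets, indexed by the Booleans. -/
def psetPair (A B : PSet.{u}) : PSet.{u} := ⟨ULift Bool, fun i => bif i.down then A else B⟩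

theorem mk_psetPair (A B : PSet.{u}) :
    ZFSet.mk (psetPair A B) = {ZFSet.mk A, ZFSet.mk B} := by
  ext z
  induction z using Quotient.inductionOn with
  | h z =>
    refine Iff.trans ?_ ZFSet.mem_pair.symm
    change z ∈ psetPair A B ↔ ZFSet.mk z = ZFSet.mk A ∨ ZFSet.mk z = ZFSet.mk B
    rw [ZFSet.eq, ZFSet.eq]
    constructor
    · rintro ⟨⟨i⟩, hi⟩
      cases i
      · exact Or.inr hi
      · exact Or.inl hi
    · rintro (h | h)
      · exact ⟨⟨true⟩, h⟩
      · exact ⟨⟨false⟩, h⟩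

theorem upair_check (A B : PSet.{u}) :
    upair (check A : PName.{u} P) (check B) = check (psetPair A B) := by
  simp only [upair, psetPair, check]
  congr 1
  funext i
  cases i.down <;> rfl

theorem mk_ofNat_mem {m n : ℕ} (h : m < n) :
    ZFSet.mk (PSet.ofNat.{u} m) ∈ ZFSet.mk (PSet.ofNat.{u} n) := by
  induction n with
  | zero => omega
  | succ n ih =>
    change ZFSet.mk (PSet.ofNat m) ∈ insert (ZFSet.mk (PSet.ofNat n)) (ZFSet.mk (PSet.ofNat n))
    rw [ZFSet.mem_insert_iff]
    rcases Nat.lt_succ_iff_lt_or_eq.1 h with h | rfl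
    · exact Or.inr (ih h)
    · exact Or.inl rfl

theorem mk_ofNat_injective : Function.Injective fun n => ZFSet.mk (PSet.ofNat.{u} n) := by
  intro m n h
  dsimp only at h
  by_contra hne
  rcases lt_or_gt_of_ne hne with h' | h'
  · have := mk_ofNat_mem.{u} h'
    rw [h] at this
    exact ZFSet.mem_irrefl _ this
  · have := mk_ofNat_mem.{u} h'
    rw [h] at this
    exact ZFSet.mem_irrefl _ this

/-- Pairs of numerals are check names, and forced equality of check names is true equality of sets
in V. -/
theorem eq_of_forces_opair {n m n' m' : ℕ} {p : P}
    (h : p ⊩ eq (opair (num n) (num m) : PName.{u} P) (opair (num n') (num m'))) :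
    n = n' ∧ m = m' := by
  simp only [opair, num, upair_check] at h
  have h' := ZFSet.sound (equiv_of_forces_eq_check _ _ _ h)
  simp only [mk_psetPair] at h'
  have key : ∀ a b : ZFSet.{u}, ({{a, a}, {a, b}} : ZFSet) = ZFSet.pair a b := fun a b => by
    rw [ZFSet.pair, ZFSet.pair_eq_singleton]
  rw [key, key, ZFSet.pair_inj] at h'
  exact ⟨mk_ofNat_injective h'.1, mk_ofNat_injective h'.2⟩

theorem forces_valueEq_groundReal (f : ℕ → ℕ) (n : ℕ) (p : P) :
    p ⊩ ForcingProp.valueEq (groundReal.{u} f) n (f n) :=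
  fun q _ => ⟨q, le_rfl, ⟨n⟩, le_top, eq_refl _ _⟩

end PName

/-! ### Names for reals -/

namespace ForcingProp

open PName

section

variable {P : Type v} [Preorder P] [OrderTop P] {x y : PName.{u} P} {p : P}

theorem forces_eventuallyLE_iff : p ⊩ eventuallyLE x y ↔
    ∀ q ≤ p, ∃ N, ∃ r ≤ q, ∀ n ≥ N, ∀ s ≤ r, ∃ t ≤ s, ∃ i j, i ≤ j ∧
      t ⊩ valueEq x n i ∧ t ⊩ valueEq y n j := by
  rw [eventuallyLE, forces_ex_iff]
  refine forall₂_congr fun q _ => exists_congr fun N => exists_congr fun r =>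
    and_congr_right fun _ => forall_congr' fun n => ?_
  change (r ⊩ imp (ground (N ≤ n)) _) ↔ _
  rw [forces_imp_iff]
  constructor
  · intro h hn s hs
    obtain ⟨t, ht, ht'⟩ := h s hs hn
    rw [forces_ex_iff] at ht'
    obtain ⟨i, t₁, ht₁, h₁⟩ := ht' t le_rfl
    rw [forces_ex_iff] at h₁
    obtain ⟨j, t₂, ht₂, h₂⟩ := h₁ t₁ le_rfl
    exact ⟨t₂, ht₂.trans (ht₁.trans ht), i, j, h₂⟩
  · intro h s hs hn
    refine ⟨s, le_rfl, ?_⟩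
    rw [forces_ex_iff]
    intro s' hs'
    obtain ⟨t, ht, i, j, h'⟩ := h hn s' (hs'.trans hs)
    refine ⟨i, t, ht, ?_⟩
    rw [forces_ex_iff]
    exact fun q hq => ⟨j, q, le_rfl, h'.1, mem_mono h'.2.1 hq, mem_mono h'.2.2 hq⟩

theorem exists_le_forces_valueEq (h : p ⊩ isReal x) (n : ℕ) : ∃ q ≤ p, ∃ m,
    q ⊩ valueEq x n m ∧ ∀ r ≤ q, ∀ k, r ⊩ valueEq x n k → k = m := by
  obtain ⟨m, q, hq, h₁, h₂⟩ := forces_ex_iff.1 (h.2 n) p le_rfl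
  refine ⟨q, hq, m, h₁, fun r hr k hk => ?_⟩
  obtain ⟨s, -, hs⟩ := forces_imp_iff.1 (h₂ k) r hr hk
  exact hs

theorem isReal_mono {q : P} (h : p ⊩ isReal x) (hq : q ≤ p) : q ⊩ isReal x :=
  ⟨fun z => forces_imp_iff.2 fun r hr => forces_imp_iff.1 (h.1 z) r (hr.trans hq),
    fun n => forces_ex_iff.2 fun r hr => forces_ex_iff.1 (h.2 n) r (hr.trans hq)⟩

theorem valueEq_unique (h : p ⊩ isReal x) {n k l : ℕ} (hk : p ⊩ valueEq x n k)
    (hl : p ⊩ valueEq x n l) : k = l := by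
  obtain ⟨q, hq, m, -, hm⟩ := exists_le_forces_valueEq h n
  rw [hm q le_rfl k (mem_mono hk hq), hm q le_rfl l (mem_mono hl hq)]

end

end ForcingProp

/-! ### Reals given by a decision relation -/

namespace PName

open ForcingProp

variable {P : Type} [Preorder P] [OrderTop P] {D : P → ℕ → ℕ → Prop}

/-- The name of the real whose value at `n` is decided to be `m` by the conditions `p` with
`D p n m`. -/
def ofDecision (D : P → ℕ → ℕ → Prop) : PName.{u} P :=
  ⟨ULift.{u} {a : P × ℕ × ℕ // D a.1 a.2.1 a.2.2},
    fun a => opair (num a.down.1.2.1) (num a.down.1.2.2), fun a => a.down.1.1⟩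

theorem exists_le_decision (hmono : ∀ p q, q ≤ p → ∀ n m, D p n m → D q n m) {p : P} {n m : ℕ}
    (h : p ⊩ valueEq (ofDecision.{u} D) n m) : ∃ q ≤ p, D q n m := by
  obtain ⟨r, hr, ⟨⟨⟨s, n', m'⟩, hD⟩⟩, hrs, heq⟩ := h p le_rfl
  obtain ⟨rfl, rfl⟩ := eq_of_forces_opair heq
  exact ⟨r, hr, hmono _ _ hrs _ _ hD⟩

theorem forces_valueEq_ofDecision {p : P} {n m : ℕ} (h : D p n m) :
    p ⊩ valueEq (ofDecision.{u} D) n m :=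
  fun q hq => ⟨q, le_rfl, ⟨⟨(p, n, m), h⟩⟩, hq, eq_refl _ _⟩

theorem isReal_ofDecision (hmono : ∀ p q, q ≤ p → ∀ n m, D p n m → D q n m)
    (huniq : ∀ p n m k, D p n m → D p n k → m = k) (htot : ∀ p n, ∃ q ≤ p, ∃ m, D q n m)
    (p : P) : p ⊩ isReal (ofDecision.{u} D) := by
  refine ⟨fun z => forces_imp_iff.2 fun q _ hz => ?_, fun n => forces_ex_iff.2 fun q _ => ?_⟩
  · obtain ⟨r, hr, ⟨⟨⟨s, n, m⟩, hD⟩⟩, hrs, heq⟩ := hz q le_rfl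
    refine ⟨r, hr, forces_ex_iff.2 fun r₁ hr₁ => ⟨n, r₁, le_rfl, ?_⟩⟩
    exact forces_ex_iff.2 fun r₂ hr₂ => ⟨m, r₂, le_rfl, eq_mono heq (hr₂.trans hr₁)⟩
  · obtain ⟨r, hr, m, hD⟩ := htot q n
    refine ⟨m, r, hr, forces_valueEq_ofDecision hD, fun k => forces_imp_iff.2 fun s hs hk => ?_⟩
    obtain ⟨t, ht, hD'⟩ := exists_le_decision hmono hk
    exact ⟨t, ht, huniq t n k m hD' (hmono _ _ (ht.trans hs) _ _ hD)⟩

end PName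

/-! ### Finite sequences and diagonalization -/

theorem List.prefix_concat_of_prefix_of_ne {α : Type*} {s t : List α} (h : s <+: t) (hne : s ≠ t) :
    ∃ a, s ++ [a] <+: t := by
  obtain ⟨u, rfl⟩ := h
  cases u with
  | nil => simp at hne
  | cons a u => exact ⟨a, u, by simp⟩

theorem List.finite_concat_prefix {α : Type*} (t : List α) :
    {e : List α × α | e.1 ++ [e.2] <+: t}.Finite := by
  have : {s : List α | s <+: t}.Finite :=
    (List.finite_toSet t.inits).subset fun s hs => (List.mem_inits s t).2 hs
  refine this.preimage (f := fun e : List α × α => e.1 ++ [e.2]) fun a _ b _ h => ?_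
  simpa [Prod.ext_iff] using h

/-- Along a branch, there is a first edge with a given property. -/
theorem List.exists_first_edge {α : Type*} (Q : List α → α → Prop) (t : List α) (a : α)
    (h : Q t a) : ∃ s b, s ++ [b] <+: t ++ [a] ∧ Q s b ∧ ∀ r c, r ++ [c] <+: s → ¬ Q r c := by
  induction hn : t.length using Nat.strong_induction_on generalizing t a with
  | _ n ih =>
    by_cases h' : ∃ r c, r ++ [c] <+: t ∧ Q r c
    · obtain ⟨r, c, hr, hQ⟩ := h'
      have hlen := hr.length_le
      simp only [List.length_append, List.length_singleton] at hlen
      obtain ⟨s, b, hs, h₁, h₂⟩ := ih r.length (by omega) r c hQ rfl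
      exact ⟨s, b, hs.trans (hr.trans (List.prefix_append _ _)), h₁, h₂⟩
    · push Not at h'
      exact ⟨t, a, List.prefix_refl _, h, h'⟩

/-- Diagonalization of countably many cofinite requirements. -/
theorem Nat.exists_tendsto_forall_lt {P : ℕ → ℕ → Prop} (h : ∀ n, ∀ᶠ l in atTop, P n l) :
    ∃ H : ℕ → ℕ, Tendsto H atTop atTop ∧ ∀ l, ∀ n < H l, P n l := by
  classical
  refine ⟨fun l => Nat.findGreatest (fun p => ∀ n < p, P n l) l, ?_, fun l => ?_⟩
  · rw [tendsto_atTop]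
    intro p
    filter_upwards [(eventually_all_finite (Set.finite_lt_nat p)).2 fun n _ => h n,
      eventually_ge_atTop p] with l hl hpl
    exact Nat.le_findGreatest hpl hl
  · exact Nat.findGreatest_spec (P := fun p => ∀ n < p, P n l) (Nat.zero_le l) (by simp)

/-- Choose e strictly increasing with P (e m) m for all m; the slow inverse of e is the required φ.
-/
theorem Nat.exists_tendsto_frequently {P : ℕ → ℕ → Prop} (h : ∀ m, ∃ᶠ k in atTop, P k m) :
    ∃ φ : ℕ → ℕ, Tendsto φ atTop atTop ∧ ∃ᶠ k in atTop, P k (φ k) := by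
  classical
  obtain ⟨e, he, hP⟩ := extraction_forall_of_frequently h
  have hex : ∀ k, ∃ m, k ≤ e m := fun k => ⟨k, he.id_le k⟩
  refine ⟨fun k => Nat.find (hex k), ?_, ?_⟩
  · rw [tendsto_atTop]
    intro m
    filter_upwards [eventually_gt_atTop (e m)] with k hk
    rw [Nat.le_find_iff]
    intro i hi
    have := he hi
    omega
  · rw [frequently_atTop]
    intro m
    refine ⟨e m, he.id_le m, ?_⟩
    have : Nat.find (hex (e m)) = m := by
      rw [Nat.find_eq_iff]
      exact ⟨le_rfl, fun i hi => not_le.2 (he hi)⟩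
    change P (e m) (Nat.find (hex (e m)))
    rw [this]
    exact hP m

/-! ### Tree Hechler conditions: restriction, pruning, gluing, fusion -/

namespace TreeHechler

open Descriptive

variable {S T : TreeHechler} {s t : List ℕ}

theorem mem_of_le (h : S ≤ T) (ht : t ∈ S.tree) : t ∈ T.tree := h ht

/-- Stems can only grow: S branches at its stem, while T does not branch strictly below its own. -/
theorem stem_prefix_of_le (h : S ≤ T) : T.stem <+: S.stem := by
  rcases T.comparable _ (mem_of_le h S.stem_mem) with h' | h'
  · by_cases hne : S.stem = T.stem
    · rw [hne]
    obtain ⟨a, ha⟩ := List.prefix_concat_of_prefix_of_ne h' hne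
    obtain ⟨l, hl, hla⟩ :=
      ((S.eventually_mem _ S.stem_mem (List.prefix_refl _)).and (eventually_gt_atTop a)).exists
    have key : S.stem ++ [l] <+: T.stem ∨ T.stem <+: S.stem ++ [l] :=
      T.comparable _ (mem_of_le h hl)
    exfalso
    have : S.stem ++ [a] = S.stem ++ [l] := by
      rcases key with h₁ | h₁
      · exact (List.prefix_of_prefix_length_le ha h₁ (by simp)).eq_of_length (by simp)
      · exact (ha.trans h₁).eq_of_length (by simp)
    simp only [List.append_cancel_left_eq, List.cons.injEq, and_true] at this
    omega
  · exact h'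

/-- The subcondition of `T` with stem a node `s` extending the stem of `T`. -/
def restrict (T : TreeHechler) (s : List ℕ) (hs : s ∈ T.tree) (hT : T.stem <+: s) :
    TreeHechler where
  tree := ⟨{t | t ∈ T.tree ∧ (t <+: s ∨ s <+: t)}, by
    rintro t a ⟨h₁, h₂⟩
    refine ⟨Tree.mem_of_append h₁, ?_⟩
    rcases h₂ with h₂ | h₂
    · exact Or.inl ((List.prefix_append _ _).trans h₂)
    · exact (List.prefix_or_prefix_of_prefix (List.prefix_append t [a]) h₂)⟩
  stem := s
  stem_mem := ⟨hs, Or.inl (List.prefix_refl _)⟩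
  comparable _ h := h.2
  eventually_mem t ht hst := (T.eventually_mem t ht.1 (hT.trans hst)).mono fun _ hn =>
    ⟨hn, Or.inr (hst.trans (List.prefix_append _ _))⟩

theorem restrict_le (hs : s ∈ T.tree) (hT : T.stem <+: s) : T.restrict s hs hT ≤ T :=
  fun _ h => h.1

theorem exists_stem_eq (s : List ℕ) : ∃ T : TreeHechler, T.stem = s :=
  ⟨restrict ⊤ s trivial s.nil_prefix, rfl⟩

theorem exists_le_length_stem (T : TreeHechler) (n : ℕ) : ∃ S ≤ T, n ≤ S.stem.length := by
  induction n with
  | zero => exact ⟨T, le_rfl, Nat.zero_le _⟩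
  | succ n ih =>
    obtain ⟨S, hS, hn⟩ := ih
    obtain ⟨l, hl⟩ := (S.eventually_mem _ S.stem_mem (List.prefix_refl _)).exists
    refine ⟨S.restrict _ hl (List.prefix_append _ _), (restrict_le _ _).trans hS, ?_⟩
    simpa [restrict] using hn

theorem restrict_le_of_forall (hs : s ∈ T.tree) (hT : T.stem <+: s)
    (h : ∀ t ∈ T.tree, s <+: t → t ∈ S.tree) : T.restrict s hs hT ≤ S := by
  rintro t ⟨ht, h' | h'⟩
  · exact Tree.mem_of_prefix h' (h s hs (List.prefix_refl _))
  · exact h t ht h'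

/-- Thinning out the tree of `T` by a requirement attached to every edge above the stem. -/
def prune (T : TreeHechler) (R : List ℕ → ℕ → List ℕ → Prop)
    (hinit : ∀ s l t a, R s l (t ++ [a]) → R s l t)
    (hnew : ∀ s, ∀ᶠ l in atTop, R s l (s ++ [l]))
    (hold : ∀ s l t, s ++ [l] <+: t → R s l t → ∀ᶠ a in atTop, R s l (t ++ [a])) :
    TreeHechler where
  tree := ⟨{t | t ∈ T.tree ∧ ∀ s l, T.stem <+: s → s ++ [l] <+: t → R s l t}, by
    rintro t a ⟨h₁, h₂⟩
    exact ⟨Tree.mem_of_append h₁, fun s l hs hl =>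
      hinit s l t a (h₂ s l hs (hl.trans (List.prefix_append _ _)))⟩⟩
  stem := T.stem
  stem_mem := by
    refine ⟨T.stem_mem, fun s l hs hl => ?_⟩
    have h₁ := hs.length_le
    have h₂ := hl.length_le
    simp only [List.length_append, List.length_singleton] at h₂
    omega
  comparable t ht := T.comparable t ht.1
  eventually_mem t ht hst := by
    -- Only finitely many edges lie below t, so their old requirements and the one new requirement
    -- exclude finitely many a.
    filter_upwards [T.eventually_mem t ht.1 hst, hnew t,
      (eventually_all_finite (t.finite_concat_prefix.inter_of_left {e | T.stem <+: e.1})).2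
        fun e he => hold e.1 e.2 t he.1 (ht.2 e.1 e.2 he.2 he.1)] with a h₁ h₂ h₃
    refine ⟨h₁, fun s l hs hl => ?_⟩
    rcases List.prefix_concat_iff.1 hl with h | h
    · obtain ⟨rfl, h⟩ := List.append_inj' h rfl
      obtain rfl : l = a := by simpa using h
      exact h₂
    · exact h₃ (s, l) ⟨h, hs⟩

/-- Gluing conditions along the immediate successors of a node. -/
theorem exists_amalgam (s : List ℕ) (B : ℕ → TreeHechler) {K : ℕ}
    (hB : ∀ k ≥ K, (B k).stem = s ++ [k]) : ∃ T : TreeHechler, T.stem = s ∧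
      ∀ S ≤ T, ∃ S' ≤ S, ∃ k ≥ K, S' ≤ B k := by
  let T : TreeHechler :=
    { tree := ⟨{t | t <+: s ∨ ∃ k ≥ K, s ++ [k] <+: t ∧ t ∈ (B k).tree}, by
        rintro t a (h | ⟨k, hk, h₁, h₂⟩)
        · exact Or.inl ((List.prefix_append _ _).trans h)
        · rcases List.prefix_concat_iff.1 h₁ with h | h
          · obtain ⟨rfl, h⟩ := List.append_inj' h rfl
            exact Or.inl (List.prefix_refl _)
          · exact Or.inr ⟨k, hk, h, Tree.mem_of_append h₂⟩⟩
      stem := s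
      stem_mem := Or.inl (List.prefix_refl _)
      comparable := by
        rintro t (h | ⟨k, hk, h₁, h₂⟩)
        · exact Or.inl h
        · exact Or.inr ((List.prefix_append _ _).trans h₁)
      eventually_mem := by
        rintro t (h | ⟨k, hk, h₁, h₂⟩) hst
        · obtain rfl := h.eq_of_length_le hst.length_le
          filter_upwards [eventually_ge_atTop K] with k hk
          exact Or.inr ⟨k, hk, List.prefix_refl _, hB k hk ▸ (B k).stem_mem⟩
        · filter_upwards [(B k).eventually_mem t h₂ (hB k hk ▸ h₁)] with a ha
          exact Or.inr ⟨k, hk, h₁.trans (List.prefix_append _ _), ha⟩ }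
  refine ⟨T, rfl, fun S hS => ?_⟩
  have hstem : s <+: S.stem := stem_prefix_of_le hS
  -- One step beyond the stem of S the node is strictly longer than s, hence lies in a single `B k`.
  obtain ⟨l, hl⟩ := (S.eventually_mem _ S.stem_mem (List.prefix_refl _)).exists
  have hmem : ∀ t ∈ S.tree, S.stem ++ [l] <+: t → ∃ k ≥ K, s ++ [k] <+: t ∧ t ∈ (B k).tree := by
    intro t ht hlt
    refine (mem_of_le hS ht).resolve_left fun h => ?_
    have h₁ := (hlt.trans h).length_le
    have h₂ := hstem.length_le
    simp only [List.length_append, List.length_singleton] at h₁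
    omega
  obtain ⟨k, hk, hk₁, hk₂⟩ := hmem _ hl (List.prefix_refl _)
  refine ⟨S.restrict _ hl (List.prefix_append _ _), restrict_le _ _, k, hk,
    restrict_le_of_forall _ _ fun t ht hlt => ?_⟩
  obtain ⟨k', hk', h₁, h₂⟩ := hmem t ht hlt
  have : s ++ [k'] = s ++ [k] :=
    (List.prefix_of_prefix_length_le h₁ (hk₁.trans hlt) (by simp)).eq_of_length (by simp)
  obtain rfl : k' = k := by simpa using this
  exact h₂

/-- Fusion: given a sequence of conditions with stem `s` for every `s`, some `T' ≤ T` forces that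
for every `n`, one of finitely many conditions from the `n`-th row is in the generic filter. -/
theorem exists_fusion (T : TreeHechler) (A : List ℕ → ℕ → TreeHechler)
    (hA : ∀ s n, (A s n).stem = s) : ∃ T' ≤ T, ∀ n, ∃ F : Set (List ℕ), F.Finite ∧
      ∀ S ≤ T', ∃ S' ≤ S, ∃ s ∈ F, s ∈ T.tree ∧ T.stem <+: s ∧ S' ≤ A s n := by
  have hH : ∀ s, ∃ H : ℕ → ℕ, Tendsto H atTop atTop ∧ ∀ l, ∀ n < H l, s ++ [l] ∈ (A s n).tree :=
    fun s => Nat.exists_tendsto_forall_lt fun n =>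
      (A s n).eventually_mem s (by simpa only [hA] using (A s n).stem_mem)
        (by rw [hA])
  choose H hlim hH using hH
  -- The bound on `encode s` leaves only finitely many surviving edges with `H s l ≤ n`, which makes
  -- the set F finite.
  let R : List ℕ → ℕ → List ℕ → Prop := fun s l t =>
    Encodable.encode s ≤ H s l ∧ ∀ n < H s l, t ∈ (A s n).tree
  have hinit : ∀ s l t a, R s l (t ++ [a]) → R s l t :=
    fun s l t a h => ⟨h.1, fun n hn => Tree.mem_of_append (h.2 n hn)⟩
  have hnew : ∀ s, ∀ᶠ l in atTop, R s l (s ++ [l]) := fun s => by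
    filter_upwards [(hlim s).eventually_ge_atTop (Encodable.encode s)] with l hl
    exact ⟨hl, hH s l⟩
  have hold : ∀ s l t, s ++ [l] <+: t → R s l t → ∀ᶠ a in atTop, R s l (t ++ [a]) := by
    intro s l t hst h
    filter_upwards [(eventually_all_finite (Set.finite_lt_nat (H s l))).2 fun n hn =>
      (A s n).eventually_mem t (h.2 n hn)
        (by rw [hA]; exact (List.prefix_append _ _).trans hst)] with a ha
    exact ⟨h.1, ha⟩
  refine ⟨T.prune R hinit hnew hold, fun _ h => h.1, fun n =>
    ⟨insert T.stem ((fun e : List ℕ × ℕ => e.1 ++ [e.2]) ''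
      {e | Encodable.encode e.1 ≤ n ∧ H e.1 e.2 ≤ n}), ?_, fun S hS => ?_⟩⟩
  · refine (Set.Finite.image _ ?_).insert _
    have h₁ : {s : List ℕ | Encodable.encode s ≤ n}.Finite :=
      (Set.finite_le_nat n).preimage Encodable.encode_injective.injOn
    refine (h₁.biUnion (t := fun s => Prod.mk s '' {l | H s l ≤ n}) fun s _ =>
      Set.Finite.image _ ?_).subset ?_
    · have := (hlim s).eventually_gt_atTop n
      rw [← Nat.cofinite_eq_atTop, eventually_cofinite] at this
      simpa using this
    · rintro ⟨s, l⟩ ⟨h₁, h₂⟩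
      exact Set.mem_biUnion h₁ ⟨l, h₂, rfl⟩
  · have hstem : T.stem <+: S.stem := stem_prefix_of_le (T := T.prune R hinit hnew hold) hS
    obtain ⟨l, hl, hn⟩ := ((S.eventually_mem _ S.stem_mem (List.prefix_refl _)).and
      ((hlim S.stem).eventually_gt_atTop n)).exists
    obtain ⟨s, b, hs, ⟨hTs, hnb⟩, hmin⟩ :=
      List.exists_first_edge (fun s b => T.stem <+: s ∧ n < H s b) S.stem l ⟨hstem, hn⟩
    have hsS : s ∈ S.tree := Tree.mem_of_prefix ((List.prefix_append _ _).trans hs) hl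
    have hsT := mem_of_le hS hsS
    refine ⟨S.restrict _ hl (List.prefix_append _ _), restrict_le _ _, s, ?_, hsT.1, hTs,
      restrict_le_of_forall _ _ fun t ht hlt =>
        ((mem_of_le hS ht).2 s b hTs (hs.trans hlt)).2 n hnb⟩
    -- By minimality the last edge of s, if above the stem of T, has H at most n, so s is among the
    -- listed nodes.
    rcases List.eq_nil_or_concat s with h | ⟨r, c, rfl⟩
    · subst h
      exact Or.inl (List.prefix_nil.1 hTs).symm
    · rw [List.concat_eq_append] at *
      rcases List.prefix_concat_iff.1 hTs with h | h
      · exact Or.inl h.symm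
      · have h₁ : H r c ≤ n := not_lt.1 fun h' => hmin r c (List.prefix_refl _) ⟨h, h'⟩
        exact Or.inr ⟨(r, c), ⟨(hsT.2 r c h (List.prefix_refl _)).1.trans h₁, h₁⟩, rfl⟩

end TreeHechler

/-! ### The dominating real y -/

namespace TreeHechler

open Descriptive PName ForcingProp

variable {S T : TreeHechler}

/-- The condition `T` decides the value at `n` of the real whose value is `φ s (d |s|)`, where `s`
is the first initial segment of the generic real `d` with `n < g s`, to be `m`. -/
def Decides (g : List ℕ → ℕ) (φ : List ℕ → ℕ → ℕ) (T : TreeHechler) (n m : ℕ) : Prop :=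
  ∃ s k, s ++ [k] <+: T.stem ∧ n < g s ∧ (∀ r c, r ++ [c] <+: s → g r ≤ n) ∧ m = φ s k

section Decides

variable {g : List ℕ → ℕ} {φ : List ℕ → ℕ → ℕ}

theorem Decides.mono (S T : TreeHechler) (h : T ≤ S) (n m : ℕ) (hS : Decides g φ S n m) :
    Decides g φ T n m := by
  obtain ⟨s, k, hs, h'⟩ := hS
  exact ⟨s, k, hs.trans (stem_prefix_of_le h), h'⟩

theorem Decides.unique (T : TreeHechler) (n m k : ℕ) (hm : Decides g φ T n m)
    (hk : Decides g φ T n k) : m = k := by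
  obtain ⟨s, a, hs, hgs, hmins, rfl⟩ := hm
  obtain ⟨t, b, ht, hgt, hmint, rfl⟩ := hk
  have key : ∀ {s t a b}, s ++ [a] <+: T.stem → t ++ [b] <+: T.stem → n < g s →
      (∀ r c, r ++ [c] <+: t → g r ≤ n) → ¬ s.length < t.length :=
    fun {s t a b} hs ht hg hmin hlt => by
      have : s ++ [a] <+: t := List.prefix_of_prefix_length_le hs
        ((List.prefix_append _ _).trans ht) (by simpa using hlt)
      have := hmin _ _ this
      omega
  have h₁ := key hs ht hgs hmint
  have h₂ := key ht hs hgt hmins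
  have : s ++ [a] = t ++ [b] :=
    (List.prefix_of_prefix_length_le hs ht (by simp; omega)).eq_of_length (by simp; omega)
  obtain ⟨rfl, h⟩ := List.append_inj' this rfl
  obtain rfl : a = b := by simpa using h
  rfl

theorem Decides.exists_le (hg : ∀ s, s.length < g s) (T : TreeHechler) (n : ℕ) :
    ∃ S ≤ T, ∃ m, Decides g φ S n m := by
  obtain ⟨S, hS, hn⟩ := T.exists_le_length_stem n
  obtain ⟨l, hl⟩ := (S.eventually_mem _ S.stem_mem (List.prefix_refl _)).exists
  obtain ⟨s, b, hs, h₁, h₂⟩ := List.exists_first_edge (fun s _ => n < g s) S.stem l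
    (hn.trans_lt (hg _))
  exact ⟨S.restrict _ hl (List.prefix_append _ _), (restrict_le _ _).trans hS, _,
    s, b, hs, h₁, fun r c hr => not_lt.1 (h₂ r c hr), rfl⟩

theorem isReal_ofDecision_decides (hg : ∀ s, s.length < g s) (T : TreeHechler) :
    T ⊩ isReal (ofDecision.{u} (Decides g φ)) :=
  isReal_ofDecision Decides.mono Decides.unique (Decides.exists_le hg) T

theorem isDominating_ofDecision_decides (hg : ∀ s, s.length < g s)
    (hφ : ∀ s, Tendsto (φ s) atTop atTop) (T : TreeHechler) :
    T ⊩ isDominating (ofDecision.{u} (Decides g φ)) := by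
  refine ⟨isReal_ofDecision_decides hg T, fun f => forces_eventuallyLE_iff.2 fun q _ => ?_⟩
  have hnew : ∀ s, ∀ᶠ l in atTop, ∀ n < g s, f n ≤ φ s l := fun s =>
    (eventually_all_finite (Set.finite_lt_nat (g s))).2 fun n _ =>
      (hφ s).eventually_ge_atTop (f n)
  let r := q.prune (fun s l _ => ∀ n < g s, f n ≤ φ s l) (fun _ _ _ _ h => h) hnew
    (fun _ _ _ _ h => Eventually.of_forall fun _ => h)
  -- From N on, the node deciding the value lies beyond the stem of q, where the pruning applies.
  obtain ⟨N, hN⟩ : ∃ N, ∀ s, s <+: q.stem → g s ≤ N := by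
    refine ⟨q.stem.inits.toFinset.sup g, fun s hs => Finset.le_sup ?_⟩
    simpa using hs
  refine ⟨N, r, fun _ h => h.1, fun n hn s hs => ?_⟩
  obtain ⟨t, ht, m, hD⟩ := Decides.exists_le (φ := φ) hg s n
  refine ⟨t, ht, f n, m, ?_, forces_valueEq_groundReal f n t, forces_valueEq_ofDecision hD⟩
  obtain ⟨σ, k, hσ, hgσ, -, rfl⟩ := hD
  have hqt : q.stem <+: t.stem := stem_prefix_of_le (T := r) (ht.trans hs)
  have hqσ : q.stem <+: σ := by
    refine (List.prefix_or_prefix_of_prefix hqt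
      ((List.prefix_append _ _).trans hσ)).resolve_right fun h => ?_
    have := hN σ h
    omega
  exact (mem_of_le (ht.trans hs) t.stem_mem).2 σ k hqσ hσ n hgσ

end Decides

/-! ### Unbounded reals and favoring nodes -/

/-- No extension of `T` forces a value of `x` at `n` larger than `m`. -/
def Bounds (x : PName.{u} TreeHechler) (n m : ℕ) (T : TreeHechler) : Prop :=
  ∀ S ≤ T, ∀ i, S ⊩ valueEq x n i → i ≤ m

/-- For every `m`, infinitely many successors of the node `s` are not the stem of a condition
bounding `x` at `n` by `m`. -/
def FavorsLarge (x : PName.{u} TreeHechler) (s : List ℕ) (n : ℕ) : Prop :=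
  ∀ m, ∃ᶠ k in atTop, ∀ T : TreeHechler, T.stem = s ++ [k] → ¬ Bounds x n m T

variable {x : PName.{u} TreeHechler}

theorem exists_bounds_of_not_favorsLarge {s : List ℕ} {n : ℕ} (h : ¬ FavorsLarge x s n) :
    ∃ m, ∃ T : TreeHechler, T.stem = s ∧ Bounds x n m T := by
  simp only [FavorsLarge, not_forall, not_frequently, not_not, eventually_atTop] at h
  obtain ⟨m, K, h⟩ := h
  have : ∀ k, ∃ B : TreeHechler, k ≥ K → B.stem = s ++ [k] ∧ Bounds x n m B := fun k => by
    by_cases hk : k ≥ K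
    · obtain ⟨B, h₁, h₂⟩ := h k hk
      exact ⟨B, fun _ => ⟨h₁, h₂⟩⟩
    · exact ⟨⊤, fun h' => absurd h' hk⟩
  choose B hB using this
  obtain ⟨T, hT, hT'⟩ := exists_amalgam s B fun k hk => (hB k hk).1
  refine ⟨m, T, hT, fun S hS i hi => ?_⟩
  obtain ⟨S', hS', k, hk, hSB⟩ := hT' S hS
  exact (hB k hk).2 S' hSB i (mem_mono hi hS')

/-- If from `N` on no node of `T` favors large values of `x`, then `T` does not force `x` to be
unbounded. -/
theorem exists_le_eventuallyLE (hx : T ⊩ isReal x) (N : ℕ)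
    (h : ∀ s ∈ T.tree, T.stem <+: s → ∀ n ≥ N, ¬ FavorsLarge x s n) :
    ∃ S ≤ T, ∃ f : ℕ → ℕ, S ⊩ eventuallyLE x (groundReal f) := by
  have : ∀ s n, ∃ m, ∃ B : TreeHechler, B.stem = s ∧
      (s ∈ T.tree → T.stem <+: s → n ≥ N → Bounds x n m B) := fun s n => by
    by_cases hs : s ∈ T.tree ∧ T.stem <+: s ∧ n ≥ N
    · obtain ⟨m, B, h₁, h₂⟩ := exists_bounds_of_not_favorsLarge (h s hs.1 hs.2.1 n hs.2.2)
      exact ⟨m, B, h₁, fun _ _ _ => h₂⟩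
    · obtain ⟨B, hB⟩ := exists_stem_eq s
      exact ⟨0, B, hB, fun h₁ h₂ h₃ => absurd ⟨h₁, h₂, h₃⟩ hs⟩
  choose b A hA hb using this
  obtain ⟨S, hS, hF⟩ := T.exists_fusion A hA
  choose F hfin hF using hF
  have hf : ∀ n, ∃ c, ∀ s ∈ F n, b s n ≤ c := fun n => by
    obtain ⟨c, hc⟩ := ((hfin n).image fun s => b s n).bddAbove
    exact ⟨c, fun s hs => hc ⟨s, hs, rfl⟩⟩
  choose f hf using hf
  refine ⟨S, hS, f, forces_eventuallyLE_iff.2 fun q hq => ⟨N, q, le_rfl, fun n hn r hr => ?_⟩⟩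
  obtain ⟨r', hr', s, hs, hsT, hTs, hrA⟩ := hF n r (hr.trans hq)
  have hrT : r' ≤ T := hr'.trans (hr.trans (hq.trans hS))
  obtain ⟨t, ht, i, hi, -⟩ := exists_le_forces_valueEq (isReal_mono hx hrT) n
  exact ⟨t, ht.trans hr', i, f n, (hb s n hsT hTs hn t (ht.trans hrA) i hi).trans (hf n s hs),
    hi, forces_valueEq_groundReal f n t⟩

/-- Take some n ≥ |s| with the property if there is one, otherwise the largest n with it. Thus one
choice per node is large whenever s is long and some large n works. -/
theorem exists_forall_min_length_le (p : List ℕ → ℕ → Prop) :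
    ∃ ν : List ℕ → ℕ, ∀ s n, p s n → p s (ν s) ∧ min n s.length ≤ ν s := by
  suffices ∀ s : List ℕ, ∃ ν, ∀ n, p s n → p s ν ∧ min n s.length ≤ ν by
    choose ν hν using this
    exact ⟨ν, hν⟩
  intro s
  classical
  by_cases h : ∃ n ≥ s.length, p s n
  · obtain ⟨ν, hν, hp⟩ := h
    exact ⟨ν, fun n _ => ⟨hp, (min_le_right _ _).trans hν⟩⟩
  · push Not at h
    refine ⟨Nat.findGreatest (p s) s.length, fun n hn => ?_⟩
    have hlt : n ≤ s.length := le_of_not_ge fun h' => h n h' hn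
    exact ⟨Nat.findGreatest_spec hlt hn,
      (min_le_left _ _).trans (Nat.le_findGreatest hlt hn)⟩

/-- If nodes favoring large values of `x` are dense, then some dominating real does not eventually
dominate `x`. -/
theorem exists_isDominating_not_eventuallyLE (hx : T ⊩ isReal x)
    (h : ∀ S ≤ T, ∀ N, ∃ s ∈ S.tree, S.stem <+: s ∧ ∃ n ≥ N, FavorsLarge x s n) :
    ∃ y : PName.{u} TreeHechler, T ⊩ isDominating y ∧ T ⊩ not (eventuallyLE x y) := by
  obtain ⟨ν, hν⟩ := exists_forall_min_length_le (FavorsLarge x)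
  have : ∀ s, ∃ φ : ℕ → ℕ, Tendsto φ atTop atTop ∧ (FavorsLarge x s (ν s) →
      ∃ᶠ k in atTop, ∀ T : TreeHechler, T.stem = s ++ [k] → ¬ Bounds x (ν s) (φ k) T) :=
    fun s => by
      by_cases hs : FavorsLarge x s (ν s)
      · obtain ⟨φ, h₁, h₂⟩ := Nat.exists_tendsto_frequently hs
        exact ⟨φ, h₁, fun _ => h₂⟩
      · exact ⟨id, tendsto_id, fun h' => absurd h' hs⟩
  choose φ hlim hφ using this
  let g : List ℕ → ℕ := fun s => max s.length (ν s) + 1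
  have hg : ∀ s, s.length < g s := fun s => Nat.lt_succ_of_le (le_max_left _ _)
  have hgν : ∀ s, ν s < g s := fun s => Nat.lt_succ_of_le (le_max_right _ _)
  refine ⟨ofDecision (Decides g φ), isDominating_ofDecision_decides hg hlim T, fun q hq hle => ?_⟩
  obtain ⟨N, r, hr, hr'⟩ := forces_eventuallyLE_iff.1 hle q le_rfl
  obtain ⟨r₁, hr₁, hN⟩ := r.exists_le_length_stem N
  obtain ⟨s, hs, hrs, n, hn, hgood⟩ := h r₁ (hr₁.trans (hr.trans hq)) N
  obtain ⟨hgood, hnν⟩ := hν s n hgood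
  have hNν : N ≤ ν s := (le_min hn (hN.trans hrs.length_le)).trans hnν
  -- If an edge below s already decides y(ν(s)), the value M does not depend on k and favoring beats
  -- it; otherwise the edge s⌢k decides it as φ_s(k), and the choice of φ_s applies.
  have hfreq : ∃ᶠ k in atTop, ∃ M, (∀ T : TreeHechler, T.stem = s ++ [k] →
      ¬ Bounds x (ν s) M T) ∧ ∀ T : TreeHechler, T.stem = s ++ [k] → Decides g φ T (ν s) M := by
    by_cases hmin : ∃ r c, r ++ [c] <+: s ∧ ν s < g r
    · obtain ⟨r, c, hrc, hr⟩ := hmin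
      obtain ⟨t, b, ht, h₁, h₂⟩ := List.exists_first_edge (fun t _ => ν s < g t) r c hr
      refine (hgood (φ t b)).mono fun k hk => ⟨φ t b, hk, fun T hT => ⟨t, b, ?_, h₁,
        fun r c hr => not_lt.1 (h₂ r c hr), rfl⟩⟩
      rw [hT]
      exact ht.trans (hrc.trans (List.prefix_append _ _))
    · push Not at hmin
      exact (hφ s hgood).mono fun k hk =>
        ⟨φ s k, hk, fun T hT => ⟨s, k, by rw [hT], hgν s, hmin, rfl⟩⟩
  obtain ⟨k, ⟨M, hk, hM⟩, hsk⟩ := (hfreq.and_eventually (r₁.eventually_mem s hs hrs)).exists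
  let r₂ := r₁.restrict _ hsk (hrs.trans (List.prefix_append _ _))
  have hr₂ : r₂ ≤ r := (restrict_le _ _).trans hr₁
  have hnb := hk r₂ rfl
  simp only [Bounds, not_forall, not_le] at hnb
  obtain ⟨p, hp, i, hi, hMi⟩ := hnb
  obtain ⟨t, ht, i', j, hij, hi', hj⟩ := hr' (ν s) hNν p (hp.trans hr₂)
  have htT : t ≤ T := ht.trans (hp.trans (hr₂.trans (hr.trans hq)))
  have h₁ : i = i' := valueEq_unique (isReal_mono hx htT) (mem_mono hi ht) hi'
  have h₂ : M = j := valueEq_unique (isReal_ofDecision_decides hg t)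
    (forces_valueEq_ofDecision (Decides.mono _ _ (ht.trans hp) _ _ (hM r₂ rfl))) hj
  omega

end TreeHechler

/-- In the generic extension of `V` by tree Hechler forcing, for every unbounded real `x` there is
a dominating real `y` such that `x` is not eventually dominated by `y`. -/
theorem theorem1 (T : TreeHechler) :
    T ⊩ ForcingProp.all fun x : PName.{u} TreeHechler =>
      ForcingProp.imp (ForcingProp.isUnbounded x)
        (ForcingProp.ex fun y : PName.{u} TreeHechler =>
          ForcingProp.and (ForcingProp.isDominating y)
            (ForcingProp.not (ForcingProp.eventuallyLE x y))) := by
  intro x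
  refine ForcingProp.forces_imp_iff.2 fun q _ hx =>
    ⟨q, le_rfl, ForcingProp.forces_ex_iff.2 fun p hp => ?_⟩
  have hreal : p ⊩ ForcingProp.isReal x := ForcingProp.isReal_mono hx.1 hp
  obtain ⟨y, hy⟩ := TreeHechler.exists_isDominating_not_eventuallyLE hreal fun S hS N => by
    by_contra hcon
    push Not at hcon
    obtain ⟨S', hS', f, hf⟩ :=
      TreeHechler.exists_le_eventuallyLE (ForcingProp.isReal_mono hreal hS) N hcon
    exact hx.2 f S' (hS'.trans (hS.trans hp)) hf
  exact ⟨y, p, le_rfl, hy⟩
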